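/- Let $E$ be a separable complex Hilbert space and let $H^2_E(\mathbb D)$ be the $E$-valued Hardy space, regarded as the closed subspace of $L^2_E(\mathbb T)$ of functions whose negative Fourier coefficients vanish. Let $S_E$ be the shift $f\mapsto zf$ on $H^2_E(\mathbb D)$, and let $P_E$ be the orthogonal projection of $H^2_E(\mathbb D)$ onto the constant functions, which are identified with $E$. Let $D_E$ be differentiation on $E$-valued polynomials: $D_E\big(\sum_{n=0}^{M} z^n e_n\big)=\sum_{n=1}^{M} n z^{n-1}e_n$. For an essentially bounded measurable function $\Phi\in L^\infty_{\mathcal B(E)}(\mathbb T)$, let $H_\Phi=P_{H^2_E(\mathbb D)}M_\Phi J|_{H^2_E(\mathbb D)}$ be the Hankel operator with symbol $\Phi$, where $M_\Phi$ is multiplication by $\Phi$ and $(Jf)(z)=f(\bar z)$ on $L^2_E(\mathbb T)$. An operator $T$ on a Hilbert space is similar to a contraction if $\|X^{-1}TX\|\le 1$ for some bounded invertible operator $X$. **Theorem.** For every $\Phi\in L^\infty_{\mathcal B(E)}(\mathbb T)$, the operator $$\begin{bmatrix} S_E & H_\Phi\\ 0 & S_E^*\end{bmatrix}\quad\text{on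 } H^2_E(\mathbb D)\oplus H^2_E(\mathbb D)$$ is similar to a contraction if and only if both of the following hold: 1. $H_\Phi D_E$, defined on $E$-valued polynomials, extends to a bounded linear operator on $H^2_E(\mathbb D)$ (again denoted $H_\Phi D_E$; it is unique, as polynomials are dense); 2. there is a bounded analytic function $\Psi:\mathbb D\to\mathcal B(E)$ (that is, $\Psi\in H^\infty_{\mathcal B(E)}(\mathbb D)$) such that $(H_\Phi D_E S_E)^*P_E=\Psi P_E$, that is, for every $f\in H^2_E(\mathbb D)$, the function $(H_\Phi D_E S_E)^*P_Ef$ is the product of $\Psi$ and $P_Ef$ on $\mathbb D$. -/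

import Mathlib

open MeasureTheory AddCircle
open scoped ENNReal

noncomputable section

namespace FoguelHankel

/-! ### Similarity to a contraction -/

/-- `T` is similar to a contraction: `X⁻¹ T X` is a contraction for some bounded invertible `X`. -/
def IsSimilarToContraction {K : Type*} [NormedAddCommGroup K] [InnerProductSpace ℂ K]
    (T : K →L[ℂ] K) : Prop :=
  ∃ X : (K →L[ℂ] K)ˣ, ‖(↑X⁻¹ : K →L[ℂ] K) * T * (X : K →L[ℂ] K)‖ ≤ 1

/-- The upper triangular block operator `[[Y, X], [0, Z]]` on the Hilbert space direct sum
`K ⊕ K`. -/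
def blockUpper {K : Type*} [NormedAddCommGroup K] [InnerProductSpace ℂ K]
    (Y X Z : K →L[ℂ] K) : WithLp 2 (K × K) →L[ℂ] WithLp 2 (K × K) :=
  ((WithLp.prodContinuousLinearEquiv 2 ℂ K K).symm : (K × K) →L[ℂ] WithLp 2 (K × K)) ∘L
    ((Y ∘L ContinuousLinearMap.fst ℂ K K + X ∘L ContinuousLinearMap.snd ℂ K K).prod
      (Z ∘L ContinuousLinearMap.snd ℂ K K)) ∘L
    (WithLp.prodContinuousLinearEquiv 2 ℂ K K : WithLp 2 (K × K) →L[ℂ] (K × K))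

variable {E : Type*} [NormedAddCommGroup E] [InnerProductSpace ℂ E]

/-! ### The circle, `L²` and `L^∞`

The unit circle is parametrized by `t ↦ z = exp (2 π i t)`, `t ∈ ℝ / ℤ`, with normalized Haar
measure. Thus `fourier n` is `zⁿ`, and `z ↦ z̄` is `t ↦ -t`. -/

/-- The space `L²_E(𝕋)`. -/
abbrev L2 (E : Type*) [NormedAddCommGroup E] : Type _ :=
  Lp E 2 (haarAddCircle : Measure UnitAddCircle)

/-- (Representatives of) elements of `L^∞_{B(E)}(𝕋)`: operator-valued functions `Φ` which are
measurable in the strong operator sense (every `t ↦ Φ(t) e` is measurable) and essentially bounded.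
For separable `E` this measurability is the same as measurability of all the functions
`t ↦ ⟪Φ(t) e, e'⟫`. -/
structure LInfty (E : Type*) [NormedAddCommGroup E] [InnerProductSpace ℂ E] where
  /-- the underlying function -/
  toFun : UnitAddCircle → E →L[ℂ] E
  measurable : ∀ e : E,
    AEStronglyMeasurable (fun t => toFun t e) (haarAddCircle : Measure UnitAddCircle)
  bounded : ∃ C : ℝ, ∀ᵐ t ∂(haarAddCircle : Measure UnitAddCircle), ‖toFun t‖ ≤ C

theorem LInfty.aestronglyMeasurable_apply (Φ : LInfty E) {f : UnitAddCircle → E}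
    (hf : AEStronglyMeasurable f (haarAddCircle : Measure UnitAddCircle)) :
    AEStronglyMeasurable (fun t => Φ.toFun t (f t))
      (haarAddCircle : Measure UnitAddCircle) := by
  have hs : ∀ s : SimpleFunc UnitAddCircle E,
      AEStronglyMeasurable (fun t => Φ.toFun t (s t))
        (haarAddCircle : Measure UnitAddCircle) := by
    intro s
    induction s using SimpleFunc.induction with
    | const c hs =>
      rename_i s
      refine ((Φ.measurable c).indicator hs).congr (Filter.Eventually.of_forall fun t => ?_)
      by_cases ht : t ∈ s <;> simp [ht, SimpleFunc.coe_piecewise]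
    | add _ hf hg =>
      refine (hf.add hg).congr (Filter.Eventually.of_forall fun t => ?_)
      simp
  obtain ⟨g, hg, hfg⟩ := hf
  have : AEStronglyMeasurable (fun t => Φ.toFun t (g t))
      (haarAddCircle : Measure UnitAddCircle) :=
    aestronglyMeasurable_of_tendsto_ae Filter.atTop (fun n => hs (hg.approx n))
      (Filter.Eventually.of_forall fun t =>
        ((Φ.toFun t).continuous.tendsto _).comp (hg.tendsto_approx t))
  refine this.congr ?_
  filter_upwards [hfg] with t ht
  rw [ht]

theorem LInfty.memLp_apply (Φ : LInfty E) (f : L2 E) :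
    MemLp (fun t => Φ.toFun t (f t)) 2 (haarAddCircle : Measure UnitAddCircle) := by
  obtain ⟨C, hC⟩ := Φ.bounded
  refine (Lp.memLp f).of_le_mul (c := C) (Φ.aestronglyMeasurable_apply (Lp.aestronglyMeasurable f)) ?_
  filter_upwards [hC] with t ht
  exact (Φ.toFun t).le_of_opNorm_le ht _

/-- The multiplication operator `M_Φ f = Φ f` on `L²_E(𝕋)`. -/
def LInfty.mulOp (Φ : LInfty E) : L2 E →L[ℂ] L2 E :=
  LinearMap.mkContinuousOfExistsBound
    { toFun := fun f => (Φ.memLp_apply f).toLp _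
      map_add' := fun f g => by
        rw [← MemLp.toLp_add]
        refine MemLp.toLp_congr _ _ ?_
        filter_upwards [Lp.coeFn_add f g] with t ht
        rw [ht, Pi.add_apply, Pi.add_apply, map_add]
      map_smul' := fun c f => by
        rw [RingHom.id_apply, ← MemLp.toLp_const_smul]
        refine MemLp.toLp_congr _ _ ?_
        filter_upwards [Lp.coeFn_smul c f] with t ht
        rw [ht, Pi.smul_apply, Pi.smul_apply, map_smul] }
    (by
      obtain ⟨C, hC⟩ := Φ.bounded
      refine ⟨C, fun f => Lp.norm_le_mul_norm_of_ae_le_mul ?_⟩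
      filter_upwards [hC, (Φ.memLp_apply f).coeFn_toLp] with t ht h
      simp only [LinearMap.coe_mk, AddHom.coe_mk]
      rw [h]
      exact (Φ.toFun t).le_of_opNorm_le ht _)

theorem LInfty.coeFn_mulOp (Φ : LInfty E) (f : L2 E) :
    Φ.mulOp f =ᵐ[haarAddCircle] fun t => Φ.toFun t (f t) :=
  (Φ.memLp_apply f).coeFn_toLp

/-- The flip `(J f)(z) = f(z̄)` on `L²_E(𝕋)`. -/
def flip (E : Type*) [NormedAddCommGroup E] [InnerProductSpace ℂ E] : L2 E →L[ℂ] L2 E :=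
  (Lp.compMeasurePreservingₗᵢ ℂ (fun t : UnitAddCircle => -t)
    (Measure.measurePreserving_neg (haarAddCircle : Measure UnitAddCircle))).toContinuousLinearMap

/-- The coordinate function `z`, as the operator-valued function `z ↦ z I`. -/
def coordZ (E : Type*) [NormedAddCommGroup E] [InnerProductSpace ℂ E] : LInfty E where
  toFun t := fourier 1 t • ContinuousLinearMap.id ℂ E
  measurable e := by
    have : Continuous fun t : UnitAddCircle => fourier 1 t • e := by fun_prop
    exact this.aestronglyMeasurable
  bounded := ⟨1, Filter.Eventually.of_forall fun t => by
    refine ContinuousLinearMap.opNorm_le_bound _ zero_le_one fun x => ?_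
    simp [norm_smul, Circle.norm_coe]⟩

/-! ### The Hardy space -/

/-- The `n`-th Fourier coefficient, as a bounded operator `L²_E(𝕋) → E`. -/
def coeffL2 (E : Type*) [NormedAddCommGroup E] [InnerProductSpace ℂ E] (n : ℤ) :
    L2 E →L[ℂ] E :=
  LinearMap.mkContinuous
    { toFun := fun f => fourierCoeff (f : UnitAddCircle → E) n
      map_add' := fun f g => by
        rw [fourierCoeff_congr_ae (Lp.coeFn_add f g), fourierCoeff.add]
        · rfl
        · exact (Lp.memLp f).integrable one_le_two
        · exact (Lp.memLp g).integrable one_le_two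
      map_smul' := fun c f => by
        rw [fourierCoeff_congr_ae (Lp.coeFn_smul c f), RingHom.id_apply]
        exact fourierCoeff.const_smul _ _ _ }
    1
    (fun f => by
      simp only [LinearMap.coe_mk, AddHom.coe_mk, one_mul]
      have hf := Lp.memLp f
      calc ‖fourierCoeff (f : UnitAddCircle → E) n‖
          ≤ ∫ t : UnitAddCircle, ‖f t‖ ∂haarAddCircle := by
            refine (norm_integral_le_integral_norm _).trans_eq (integral_congr_ae ?_)
            filter_upwards with t
            simp [norm_smul, Circle.norm_coe]
        _ = (eLpNorm f 1 haarAddCircle).toReal := by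
            rw [integral_norm_eq_lintegral_enorm hf.1, eLpNorm_one_eq_lintegral_enorm]
        _ ≤ (eLpNorm f 2 haarAddCircle).toReal :=
            ENNReal.toReal_mono hf.2.ne
              (eLpNorm_le_eLpNorm_of_exponent_le one_le_two hf.1)
        _ = ‖f‖ := (Lp.norm_def f).symm)

theorem coeffL2_apply (n : ℤ) (f : L2 E) :
    coeffL2 E n f = fourierCoeff (f : UnitAddCircle → E) n := rfl

/-- The Hardy space `H²_E(𝔻)`, regarded as a closed subspace of `L²_E(𝕋)`: the functions whose
Fourier coefficients of negative index vanish. -/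
def hardy (E : Type*) [NormedAddCommGroup E] [InnerProductSpace ℂ E] : Submodule ℂ (L2 E) :=
  ⨅ (n : ℤ) (_ : n < 0), (coeffL2 E n).ker

theorem mem_hardy {f : L2 E} :
    f ∈ hardy E ↔ ∀ n : ℤ, n < 0 → fourierCoeff (f : UnitAddCircle → E) n = 0 := by
  simp [hardy, Submodule.mem_iInf, coeffL2_apply]

theorem isClosed_hardy : IsClosed (hardy E : Set (L2 E)) := by
  simp only [hardy, Submodule.coe_iInf]
  exact isClosed_iInter fun n => isClosed_iInter fun _ => (coeffL2 E n).isClosed_ker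

instance [CompleteSpace E] : CompleteSpace (hardy E) :=
  isClosed_hardy.completeSpace_coe

/-- The value at a point `w` of the unit disc of the analytic function `∑ wⁿ f̂(n)` given by
`f ∈ H²_E(𝔻)`. (The series converges absolutely for `‖w‖ < 1`.) -/
def hardyEval (f : hardy E) (w : ℂ) : E :=
  ∑' n : ℕ, w ^ n • fourierCoeff ((f : L2 E) : UnitAddCircle → E) n

theorem fourierCoeff_fourier_smul (f : UnitAddCircle → E) (m n : ℤ) :
    fourierCoeff (fun t => fourier m t • f t) n = fourierCoeff f (n - m) := by
  simp only [fourierCoeff, smul_smul, ← fourier_add]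
  congr 1
  ext t
  congr 3
  ring

/-- The shift `S_E f = z f` on `H²_E(𝔻)`. -/
def shift (E : Type*) [NormedAddCommGroup E] [InnerProductSpace ℂ E] : hardy E →L[ℂ] hardy E :=
  ((coordZ E).mulOp ∘L (hardy E).subtypeL).codRestrict (hardy E) fun f => by
    rw [mem_hardy]
    intro n hn
    have h := mem_hardy.1 f.2 (n - 1) (by omega)
    rw [← fourierCoeff_fourier_smul] at h
    rw [← h]
    refine congrFun (fourierCoeff_congr_ae (((coordZ E).coeFn_mulOp (f : L2 E)).trans ?_)) n
    filter_upwards with t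
    simp [coordZ]

/-- The Hankel operator `H_Φ = P_{H²} M_Φ J |_{H²}`. -/
def hankel [CompleteSpace E] (Φ : LInfty E) : hardy E →L[ℂ] hardy E :=
  (hardy E).orthogonalProjectionOnto ∘L Φ.mulOp ∘L flip E ∘L (hardy E).subtypeL

/-! ### Polynomials and differentiation -/

/-- The monomial `zⁿ e ∈ H²_E(𝔻)`, depending linearly on `e`. -/
def monomial (E : Type*) [NormedAddCommGroup E] [InnerProductSpace ℂ E] [CompleteSpace E]
    (n : ℕ) :
    E →ₗ[ℂ] hardy E where
  toFun e := ⟨ContinuousMap.toLp 2 (haarAddCircle : Measure UnitAddCircle) ℂ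
      ⟨fun t => fourier n t • e, by fun_prop⟩, by
    rw [mem_hardy]
    intro k hk
    rw [fourierCoeff_congr_ae (ContinuousMap.coeFn_toLp _ _)]
    simp only [ContinuousMap.coe_mk]
    rw [fourierCoeff_fourier_smul (fun _ => e)]
    have h0 := fourierCoeff_fourier (T := (1 : ℝ)) 0
    have h1 : fourierCoeff (fun _ : UnitAddCircle => (1 : ℂ)) (k - n) = 0 := by
      have := congrFun h0 (k - n)
      rw [Pi.single_eq_of_ne (by omega)] at this
      simpa [fourierCoeff] using this
    simp only [fourierCoeff, smul_eq_mul, mul_one] at h1 ⊢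
    rw [integral_smul_const, h1, zero_smul]⟩
  map_add' e e' := by
    refine Subtype.ext ?_
    simp only [Submodule.coe_add]
    rw [← map_add]
    congr 1
    ext t
    simp
  map_smul' c e := by
    refine Subtype.ext ?_
    simp only [Submodule.coe_smul, RingHom.id_apply]
    rw [← map_smul]
    congr 1
    ext t
    exact smul_comm _ _ _

theorem coeFn_monomial [CompleteSpace E] (n : ℕ) (e : E) :
    ((monomial E n e : hardy E) : L2 E) =ᵐ[haarAddCircle]
      fun t : UnitAddCircle => fourier n t • e :=
  ContinuousMap.coeFn_toLp _ _

theorem norm_monomial [CompleteSpace E] (n : ℕ) (e : E) : ‖monomial E n e‖ = ‖e‖ := by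
  rw [Submodule.coe_norm, Lp.norm_def,
    eLpNorm_congr_norm_ae (g := fun _ : UnitAddCircle => e) (by
      filter_upwards [coeFn_monomial n e] with t ht
      rw [ht]
      simp [norm_smul, Circle.norm_coe]),
    eLpNorm_const _ (by norm_num) (IsProbabilityMeasure.ne_zero _)]
  simp

/-- The `E`-valued polynomial `∑ zⁿ pₙ` as an element of `H²_E(𝔻)`. The polynomial is given by
its finitely supported sequence `p` of coefficients. -/
def polyToHardy (E : Type*) [NormedAddCommGroup E] [InnerProductSpace ℂ E] [CompleteSpace E] :
    (ℕ →₀ E) →ₗ[ℂ] hardy E :=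
  Finsupp.lsum ℕ fun n => monomial E n

/-- The differentiation operator `D_E` on `E`-valued polynomials:
`zⁿ e ↦ n zⁿ⁻¹ e` for `n ≥ 1`, and `e ↦ 0`. -/
def diffPoly (E : Type*) [NormedAddCommGroup E] [InnerProductSpace ℂ E] :
    (ℕ →₀ E) →ₗ[ℂ] (ℕ →₀ E) :=
  Finsupp.lsum ℕ fun n => (n : ℂ) • Finsupp.lsingle (n - 1)

/-- The bounded operator `B` on `H²_E(𝔻)` extends `H_Φ D_E`, which is defined on `E`-valued
polynomials. -/
def ExtendsHankelDiff [CompleteSpace E] (Φ : LInfty E) (B : hardy E →L[ℂ] hardy E) : Prop :=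
  ∀ p : ℕ →₀ E, B (polyToHardy E p) = hankel Φ (polyToHardy E (diffPoly E p))

/-! ### The constants and `H^∞` -/

/-- `E` as a subspace of `H²_E(𝔻)`: the constant functions. -/
def constants (E : Type*) [NormedAddCommGroup E] [InnerProductSpace ℂ E] [CompleteSpace E] :
    Submodule ℂ (hardy E) :=
  LinearMap.range (monomial E 0)

instance [CompleteSpace E] : CompleteSpace (constants E) := by
  let i : E →ₗᵢ[ℂ] hardy E := ⟨monomial E 0, norm_monomial 0⟩
  have h : IsComplete (Set.range i) := by
    rw [← Set.image_univ]
    exact (isComplete_image_iff i.isometry.isUniformInducing).2 isComplete_univ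
  exact h.completeSpace_coe

/-- The orthogonal projection `P_E` of `H²_E(𝔻)` onto `E`, as an operator on `H²_E(𝔻)`. -/
def projE (E : Type*) [NormedAddCommGroup E] [InnerProductSpace ℂ E] [CompleteSpace E] :
    hardy E →L[ℂ] hardy E :=
  (constants E).starProjection

/-- `H^∞_{B(E)}(𝔻)`: bounded analytic `B(E)`-valued functions on the open unit disc. -/
structure HInfty (E : Type*) [NormedAddCommGroup E] [InnerProductSpace ℂ E] where
  /-- the underlying function (only its values on the open unit disc matter) -/
  toFun : ℂ → E →L[ℂ] E
  analytic : DifferentiableOn ℂ toFun (Metric.ball 0 1)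
  bounded : ∃ C : ℝ, ∀ w ∈ Metric.ball (0 : ℂ) 1, ‖toFun w‖ ≤ C

/-- `g = Ψ f` for `f, g ∈ H²_E(𝔻)`, `Ψ ∈ H^∞_{B(E)}(𝔻)`: the analytic function `g` is the
pointwise product of `Ψ` and `f` on the disc. -/
def HInfty.IsMul (Ψ : HInfty E) (f g : hardy E) : Prop :=
  ∀ w ∈ Metric.ball (0 : ℂ) 1, hardyEval g w = Ψ.toFun w (hardyEval f w)

end FoguelHankel

end

noncomputable section

namespace FoguelHankel

open ContinuousLinearMap (adjoint adjoint_inner_left adjoint_inner_right adjoint_adjoint)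
open Filter Topology

/-! ### Block operators -/

/-! Write `S` for the shift, `H` for the Hankel operator, `ι` for the inclusion of the constants and
`T` for the block operator. Since `S* H = H S`, the operator `β = H D S`, which sends `zⁿ e` to `(n
+ 1) H zⁿ e`, satisfies `S* β S* = β - H` once it is bounded.

Sufficiency: condition 2 says that `β* ι e = Ψ e`, and multiplication by `Ψ` is bounded and commutes
with `S`. Let `M` be its adjoint. Then `ι* M = ι* β`, and `Y = S* β` gives `H = S Y - Y S* + (1 - S
S*) M`. In the equivalent norm `‖a + Y c‖² + ‖c‖² + ‖M c‖²`, applying `T` adds `‖(1 - S S*) M c‖²`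
to the first term and removes exactly that from the last, so `T` is a contraction
(`isSimilarToContraction_blockUpper`).

Necessity uses only that the powers of `T` are bounded. Applying `S*ⁿ` to the corner of `Tⁿ⁺¹` gives
`H ∑ Sᵏ S*ᵏ` over `k ≤ n`, which is `β` on polynomials of degree at most `n`; hence `β` is bounded
(`exists_weighted_hankel`). The symbol is `Ψ(w) = ev_w β* ι`; its bound comes from following the
corners on the reproducing kernel at `w` (`norm_adjoint_iota_le`). -/

theorem withLp_prod_ext {K : Type*} {v w : WithLp 2 (K × K)} (h₁ : v.fst = w.fst)
    (h₂ : v.snd = w.snd) :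
    v = w :=
  (WithLp.equiv 2 (K × K)).injective (Prod.ext h₁ h₂)

section Block

variable {K : Type*} [NormedAddCommGroup K] [InnerProductSpace ℂ K]

theorem blockUpper_fst (Y X Z : K →L[ℂ] K) (v : WithLp 2 (K × K)) :
    (blockUpper Y X Z v).fst = Y v.fst + X v.snd := rfl

theorem blockUpper_snd (Y X Z : K →L[ℂ] K) (v : WithLp 2 (K × K)) :
    (blockUpper Y X Z v).snd = Z v.snd := rfl

theorem blockUpper_mul (Y X Z Y' X' Z' : K →L[ℂ] K) :
    blockUpper Y X Z * blockUpper Y' X' Z' =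
      blockUpper (Y * Y') (Y * X' + X * Z') (Z * Z') := by
  ext v
  refine withLp_prod_ext ?_ ?_
  · simp [blockUpper_fst, blockUpper_snd, add_assoc]
  · simp [blockUpper_snd]

theorem blockUpper_one : blockUpper (1 : K →L[ℂ] K) 0 1 = 1 := by
  ext v
  refine withLp_prod_ext ?_ ?_
  · simp [blockUpper_fst]
  · simp [blockUpper_snd]

/-- The upper right corner of the `n`-th power of `blockUpper Y X Z`. -/
def blockPowCorner (Y X Z : K →L[ℂ] K) : ℕ → (K →L[ℂ] K)
  | 0 => 0
  | n + 1 => Y * blockPowCorner Y X Z n + X * Z ^ n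

theorem blockUpper_pow (Y X Z : K →L[ℂ] K) (n : ℕ) :
    blockUpper Y X Z ^ n = blockUpper (Y ^ n) (blockPowCorner Y X Z n) (Z ^ n) := by
  induction n with
  | zero => simp [blockPowCorner, blockUpper_one]
  | succ n ih => rw [pow_succ', ih, blockUpper_mul, ← pow_succ', ← pow_succ', blockPowCorner]

theorem norm_corner_apply_le (Y X Z : K →L[ℂ] K) (x : K) :
    ‖X x‖ ≤ ‖blockUpper Y X Z‖ * ‖x‖ := by
  let v : WithLp 2 (K × K) := WithLp.toLp 2 (0, x)
  have hv : ‖v‖ = ‖x‖ := by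
    simp [v]
  have h1 : ‖X x‖ ≤ ‖blockUpper Y X Z v‖ := by
    have := WithLp.prod_norm_sq_eq_of_L2 (blockUpper Y X Z v)
    rw [blockUpper_fst] at this
    have h2 : Y v.fst + X v.snd = X x := by simp [v]
    rw [h2] at this
    refine le_of_sq_le_sq ?_ (norm_nonneg _)
    rw [this]
    nlinarith [sq_nonneg ‖(blockUpper Y X Z v).snd‖]
  rw [← hv]
  exact h1.trans ((blockUpper Y X Z).le_opNorm v)

/-- The unit `[[1, Y], [0, G]]`. -/
def blockUnit (Y : K →L[ℂ] K) (G : (K →L[ℂ] K)ˣ) :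
    (WithLp 2 (K × K) →L[ℂ] WithLp 2 (K × K))ˣ where
  val := blockUpper 1 Y G
  inv := blockUpper 1 (-(Y * ↑G⁻¹)) ↑G⁻¹
  val_inv := by rw [blockUpper_mul, ← blockUpper_one]; simp
  inv_val := by rw [blockUpper_mul, ← blockUpper_one]; simp [mul_assoc]

end Block

/-! ### Similarity -/

section Similar

variable {K : Type*} [NormedAddCommGroup K] [InnerProductSpace ℂ K]

theorem isSimilarToContraction_of_norm_le {T : K →L[ℂ] K} (L : (K →L[ℂ] K)ˣ)
    (h : ∀ x, ‖(L : K →L[ℂ] K) (T x)‖ ≤ ‖(L : K →L[ℂ] K) x‖) : IsSimilarToContraction T := by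
  refine ⟨L⁻¹, ContinuousLinearMap.opNorm_le_bound _ zero_le_one fun x => ?_⟩
  have := h ((↑L⁻¹ : K →L[ℂ] K) x)
  have h2 : (L : K →L[ℂ] K) ((↑L⁻¹ : K →L[ℂ] K) x) = x := by
    rw [← mul_apply_eq_comp, L.mul_inv]; rfl
  rw [h2] at this
  simpa using this

theorem IsSimilarToContraction.exists_pow_le {T : K →L[ℂ] K} (h : IsSimilarToContraction T) :
    ∃ C : ℝ, ∀ n : ℕ, ‖T ^ n‖ ≤ C := by
  obtain ⟨X, hX⟩ := h
  refine ⟨‖(X : K →L[ℂ] K)‖ * 1 * ‖(↑X⁻¹ : K →L[ℂ] K)‖, fun n => ?_⟩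
  have h1 : T ^ n = X * ((↑X⁻¹ : K →L[ℂ] K) * T * (X : K →L[ℂ] K)) ^ n * ↑X⁻¹ := by
    have := Units.conj_pow' X T n
    rw [this]
    simp [mul_assoc]
  have h2 : ∀ n : ℕ, ‖((↑X⁻¹ : K →L[ℂ] K) * T * (X : K →L[ℂ] K)) ^ n‖ ≤ 1 := by
    intro n
    induction n with
    | zero => exact ContinuousLinearMap.norm_id_le
    | succ n ih =>
      rw [pow_succ]
      exact (norm_mul_le _ _).trans (mul_le_one₀ ih (norm_nonneg _) hX)
  rw [h1]
  refine (norm_mul_le _ _).trans ?_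
  gcongr
  refine (norm_mul_le _ _).trans ?_
  gcongr
  exact h2 n

variable [CompleteSpace K]

/-- Take the positive square root of `1 + M* M`, which is strictly positive and so invertible. It
turns the added term `‖M c‖²` into a change of norm by a bounded invertible operator. -/
theorem exists_unit_norm_sq (M : K →L[ℂ] K) :
    ∃ G : (K →L[ℂ] K)ˣ, ∀ c, ‖(G : K →L[ℂ] K) c‖ ^ 2 = ‖c‖ ^ 2 + ‖M c‖ ^ 2 := by
  have h0 : (0 : K →L[ℂ] K) ≤ star M * M := star_mul_self_nonneg M
  have h1 : IsStrictlyPositive (1 + star M * M : K →L[ℂ] K) :=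
    IsStrictlyPositive.add_nonneg isStrictlyPositive_one h0
  have hs := h1.isUnit_cfcSqrt
  refine ⟨hs.unit, fun c => ?_⟩
  have hsa : adjoint (CFC.sqrt (1 + star M * M)) = CFC.sqrt (1 + star M * M) :=
    (IsSelfAdjoint.of_nonneg (CFC.sqrt_nonneg (1 + star M * M : K →L[ℂ] K))).star_eq
  have hmul := CFC.sqrt_mul_sqrt_self (1 + star M * M : K →L[ℂ] K) h1.nonneg
  have key : inner ℂ (CFC.sqrt (1 + star M * M) c) (CFC.sqrt (1 + star M * M) c) =
      inner ℂ c c + inner ℂ (M c) (M c) := by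
    rw [← adjoint_inner_right, hsa, ← mul_apply_eq_comp, hmul,
      ← adjoint_inner_right M, ← inner_add_right]
    rfl
  simp only [inner_self_eq_norm_sq_to_K] at key
  rw [IsUnit.unit_spec]
  exact_mod_cast key

theorem norm_apply_of_adjoint_mul {S : K →L[ℂ] K} (hS : adjoint S * S = 1) (x : K) :
    ‖S x‖ = ‖x‖ :=
  (ContinuousLinearMap.norm_map_iff_adjoint_comp_self S).2 hS x

/-- Pythagoras: the range of an isometry is orthogonal to the range of `1 - S S*`. -/
theorem norm_sq_of_isometry {S : K →L[ℂ] K} (hS : adjoint S * S = 1) (x y : K) :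
    ‖S x + (y - S (adjoint S y))‖ ^ 2 = ‖x‖ ^ 2 + ‖y - S (adjoint S y)‖ ^ 2 := by
  have h : inner ℂ (S x) (y - S (adjoint S y)) = 0 := by
    rw [← adjoint_inner_right, map_sub]
    have : adjoint S (S (adjoint S y)) = adjoint S y := DFunLike.congr_fun hS (adjoint S y)
    rw [this, sub_self, inner_zero_right]
  have := norm_add_sq_eq_norm_sq_add_norm_sq_of_inner_eq_zero _ _ h
  rw [← norm_apply_of_adjoint_mul hS x]
  linarith [this]

theorem norm_sq_eq_of_isometry {S : K →L[ℂ] K} (hS : adjoint S * S = 1) (y : K) :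
    ‖y‖ ^ 2 = ‖adjoint S y‖ ^ 2 + ‖y - S (adjoint S y)‖ ^ 2 := by
  rw [← norm_sq_of_isometry hS, add_sub_cancel]

/-- If `H` differs from `(1 - S S*) M` by `S Y - Y S*`, where `M` commutes with `S*`, then
`[[S, H], [0, S*]]` is similar to a contraction. -/
theorem isSimilarToContraction_blockUpper {S H Y M : K →L[ℂ] K} (hS : adjoint S * S = 1)
    (hM : M * adjoint S = adjoint S * M)
    (hH : H = S * Y - Y * adjoint S + (1 - S * adjoint S) * M) :
    IsSimilarToContraction (blockUpper S H (adjoint S)) := by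
  obtain ⟨G, hG⟩ := exists_unit_norm_sq M
  refine isSimilarToContraction_of_norm_le (blockUnit Y G) fun v => ?_
  set a := v.fst
  set c := v.snd
  have e1 : ‖((blockUnit Y G : (WithLp 2 (K × K) →L[ℂ] WithLp 2 (K × K))ˣ) :
      WithLp 2 (K × K) →L[ℂ] WithLp 2 (K × K)) v‖ ^ 2 =
      ‖a + Y c‖ ^ 2 + (‖c‖ ^ 2 + ‖M c‖ ^ 2) := by
    rw [WithLp.prod_norm_sq_eq_of_L2, ← hG]
    rfl
  -- The form of `H` is chosen so that the coordinate `a + Y c` is mapped by `S`, up to a defect in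
  -- the orthogonal complement of the range of `S`.
  have hfst : S a + H c + Y (adjoint S c) = S (a + Y c) + (M c - S (adjoint S (M c))) := by
    rw [hH]
    simp
    abel
  have e2 : ‖((blockUnit Y G : (WithLp 2 (K × K) →L[ℂ] WithLp 2 (K × K))ˣ) :
      WithLp 2 (K × K) →L[ℂ] WithLp 2 (K × K)) (blockUpper S H (adjoint S) v)‖ ^ 2 =
      ‖S (a + Y c) + (M c - S (adjoint S (M c)))‖ ^ 2 +
        (‖adjoint S c‖ ^ 2 + ‖adjoint S (M c)‖ ^ 2) := by
    have hMc : adjoint S (M c) = M (adjoint S c) := (DFunLike.congr_fun hM c).symm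
    rw [WithLp.prod_norm_sq_eq_of_L2, hMc, ← hG, ← hMc, ← hfst]
    rfl
  refine le_of_sq_le_sq ?_ (norm_nonneg _)
  -- The defect of `M c` occurs once on each side and cancels; only the defect of `c` is lost.
  rw [e1, e2, norm_sq_of_isometry hS, norm_sq_eq_of_isometry hS (M c),
    norm_sq_eq_of_isometry hS c]
  nlinarith [sq_nonneg ‖c - S (adjoint S c)‖]

end Similar

/-! ### Unilateral shifts -/

section Shift

variable {K E F : Type*} [NormedAddCommGroup K] [InnerProductSpace ℂ K] [CompleteSpace K]
  [NormedAddCommGroup E] [InnerProductSpace ℂ E] [CompleteSpace E]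
  [NormedAddCommGroup F] [InnerProductSpace ℂ F]

/-- The polynomial `∑ Sⁿ ι pₙ`. -/
def shiftPoly (S : K →L[ℂ] K) (ι : E →L[ℂ] K) : (ℕ →₀ E) →ₗ[ℂ] K :=
  Finsupp.lsum ℕ fun n => ((S ^ n).comp ι).toLinearMap

/-- `S` is a unilateral shift on `K`, with `ι` an isometry of `E` onto the wandering subspace. -/
structure IsUnilateralShift (S : K →L[ℂ] K) (ι : E →L[ℂ] K) : Prop where
  adjoint_mul_self : adjoint S * S = 1
  adjoint_comp_self : adjoint ι ∘L ι = ContinuousLinearMap.id ℂ E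
  comp_adjoint : ι ∘L adjoint ι = 1 - S * adjoint S
  denseRange : DenseRange (shiftPoly S ι)

omit [CompleteSpace K] [CompleteSpace E] in
theorem shiftPoly_single (S : K →L[ℂ] K) (ι : E →L[ℂ] K) (n : ℕ) (e : E) :
    shiftPoly S ι (Finsupp.single n e) = (S ^ n) (ι e) := by
  simp only [shiftPoly, Finsupp.lsum_single]
  rfl

namespace IsUnilateralShift

variable {S : K →L[ℂ] K} {ι : E →L[ℂ] K} (h : IsUnilateralShift S ι)
include h

theorem adjoint_apply_self (x : K) : adjoint S (S x) = x :=
  DFunLike.congr_fun h.adjoint_mul_self x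

theorem adjoint_iota (e : E) : adjoint ι (ι e) = e :=
  DFunLike.congr_fun h.adjoint_comp_self e

theorem iota_adjoint (x : K) : ι (adjoint ι x) = x - S (adjoint S x) :=
  DFunLike.congr_fun h.comp_adjoint x

theorem norm_shift (x : K) : ‖S x‖ = ‖x‖ := norm_apply_of_adjoint_mul h.adjoint_mul_self x

theorem norm_iota (e : E) : ‖ι e‖ = ‖e‖ :=
  (ContinuousLinearMap.norm_map_iff_adjoint_comp_self ι).2 h.adjoint_comp_self e

theorem adjoint_shift_iota (e : E) : adjoint S (ι e) = 0 := by
  have h1 := h.iota_adjoint (ι e)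
  rw [h.adjoint_iota] at h1
  have h2 : S (adjoint S (ι e)) = 0 := by
    have := sub_eq_self.1 h1.symm
    exact this
  rw [← h.adjoint_apply_self (adjoint S (ι e)), h2, map_zero]

theorem norm_shift_le_one : ‖S‖ ≤ 1 :=
  ContinuousLinearMap.opNorm_le_bound _ zero_le_one fun x => by rw [h.norm_shift, one_mul]

theorem norm_adjoint_shift_le_one : ‖adjoint S‖ ≤ 1 := by
  rw [LinearIsometryEquiv.norm_map]
  exact h.norm_shift_le_one

theorem norm_adjoint_shift_pow_apply_le (n : ℕ) (x : K) : ‖(adjoint S ^ n) x‖ ≤ ‖x‖ := by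
  induction n with
  | zero => simp
  | succ n ih =>
    rw [pow_succ']
    refine ((adjoint S).le_of_opNorm_le h.norm_adjoint_shift_le_one _).trans ?_
    rwa [one_mul]

theorem ext_on_monomials {A B : K →L[ℂ] F} (hAB : ∀ n e, A ((S ^ n) (ι e)) = B ((S ^ n) (ι e))) :
    A = B := by
  refine DFunLike.coe_injective (h.denseRange.equalizer A.continuous B.continuous ?_)
  have : (A : K →ₗ[ℂ] F) ∘ₗ shiftPoly S ι = (B : K →ₗ[ℂ] F) ∘ₗ shiftPoly S ι := by
    ext n e
    simpa [shiftPoly_single] using hAB n e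
  exact congrArg DFunLike.coe this

theorem adjoint_pow_apply_pow (n : ℕ) (x : K) : (adjoint S ^ n) ((S ^ n) x) = x := by
  induction n generalizing x with
  | zero => rfl
  | succ n ih =>
    rw [pow_succ', pow_succ]
    have : adjoint S ((adjoint S ^ n) ((S ^ n) (S x))) = x := by
      rw [ih, h.adjoint_apply_self]
    exact this

theorem pow_adjoint_pow_monomial_of_le {k j : ℕ} (hkj : k ≤ j) (e : E) :
    (S ^ k) ((adjoint S ^ k) ((S ^ j) (ι e))) = (S ^ j) (ι e) := by
  obtain ⟨l, rfl⟩ := Nat.exists_eq_add_of_le hkj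
  rw [pow_add]
  have := h.adjoint_pow_apply_pow k ((S ^ l) (ι e))
  exact congrArg (S ^ k) this

theorem adjoint_pow_monomial_of_lt {k j : ℕ} (hkj : j < k) (e : E) :
    (adjoint S ^ k) ((S ^ j) (ι e)) = 0 := by
  obtain ⟨l, rfl⟩ := Nat.exists_eq_add_of_lt hkj
  rw [show j + l + 1 = l + (1 + j) by ring, pow_add, pow_add, pow_one]
  have : (adjoint S ^ l) (adjoint S ((adjoint S ^ j) ((S ^ j) (ι e)))) = 0 := by
    rw [h.adjoint_pow_apply_pow, h.adjoint_shift_iota, map_zero]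
  exact this

/-- `Sᵏ S*ᵏ` is the projection onto the functions divisible by `zᵏ`: it fixes `zʲ e` for the `j + 1`
values `k ≤ j` and kills it for `k > j`. This is how differentiation arises from powers of the block
operator. -/
theorem sum_pow_adjoint_pow_monomial {j n : ℕ} (hjn : j ≤ n) (e : E) :
    ∑ k ∈ Finset.range (n + 1), (S ^ k) ((adjoint S ^ k) ((S ^ j) (ι e))) =
      ((j : ℂ) + 1) • (S ^ j) (ι e) := by
  have h1 : ∑ k ∈ Finset.range (j + 1), (S ^ k) ((adjoint S ^ k) ((S ^ j) (ι e))) =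
      ((j : ℂ) + 1) • (S ^ j) (ι e) := by
    rw [Finset.sum_congr rfl fun k hk =>
      h.pow_adjoint_pow_monomial_of_le (Nat.lt_succ_iff.1 (Finset.mem_range.1 hk)) e]
    rw [Finset.sum_const, Finset.card_range, ← Nat.cast_smul_eq_nsmul ℂ]
    push_cast
    rfl
  rw [← h1]
  symm
  refine Finset.sum_subset (Finset.range_mono (by omega)) fun k _ hk => ?_
  rw [h.adjoint_pow_monomial_of_lt (by simpa using hk), map_zero]

/-! #### Hankel operators and weighted Hankel operators -/

/-- In the recursion for the corner, `S*ⁿ⁺¹` cancels the leading `S` of the old term and passes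
through `H` as `Sⁿ⁺¹` in the new one. -/
theorem adjoint_pow_corner {H : K →L[ℂ] K} (hH : adjoint S * H = H * S) (n : ℕ) (x : K) :
    (adjoint S ^ n) (blockPowCorner S H (adjoint S) (n + 1) x) =
      H (∑ k ∈ Finset.range (n + 1), (S ^ k) ((adjoint S ^ k) x)) := by
  have hpow : ∀ k : ℕ, adjoint S ^ k * H = H * S ^ k := by
    intro k
    induction k with
    | zero => simp
    | succ k ih => rw [pow_succ, mul_assoc, hH, ← mul_assoc, ih, mul_assoc, ← pow_succ]
  induction n with
  | zero => simp [blockPowCorner]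
  | succ n ih =>
    rw [Finset.sum_range_succ, map_add, ← ih, blockPowCorner]
    have h1 : (adjoint S ^ (n + 1)) (H ((adjoint S ^ (n + 1)) x)) =
        H ((S ^ (n + 1)) ((adjoint S ^ (n + 1)) x)) :=
      DFunLike.congr_fun (hpow (n + 1)) _
    have h2 : (adjoint S ^ (n + 1)) (S (blockPowCorner S H (adjoint S) (n + 1) x)) =
        (adjoint S ^ n) (blockPowCorner S H (adjoint S) (n + 1) x) := by
      rw [pow_succ]
      exact congrArg _ (h.adjoint_apply_self _)
    rw [← h1, ← h2, ← map_add]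
    rfl

theorem exists_weighted_hankel {H : K →L[ℂ] K} (hH : adjoint S * H = H * S) {C : ℝ}
    (hC : ∀ n x, ‖blockPowCorner S H (adjoint S) n x‖ ≤ C * ‖x‖) :
    ∃ β : K →L[ℂ] K, ∀ (n : ℕ) e, β ((S ^ n) (ι e)) = ((n : ℂ) + 1) • H ((S ^ n) (ι e)) := by
  let f : (ℕ →₀ E) →ₗ[ℂ] K := Finsupp.lsum ℕ fun n =>
    ((n : ℂ) + 1) • (H.comp ((S ^ n).comp ι)).toLinearMap
  have hf : ∀ n e, f (Finsupp.single n e) = ((n : ℂ) + 1) • H ((S ^ n) (ι e)) := by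
    intro n e
    simp only [f, Finsupp.lsum_single]
    rfl
  have hbound : ∀ p, ‖f p‖ ≤ C * ‖shiftPoly S ι p‖ := by
    intro p
    obtain ⟨N, hN⟩ : ∃ N : ℕ, ∀ n ∈ p.support, n ≤ N :=
      ⟨p.support.sup id, fun n hn => Finset.le_sup (f := id) hn⟩
    -- A single power, with `N` at least the degree of `p`, handles all monomials of `p` at once, so
    -- the bound on the corners transfers without loss.
    have h1 : f p = (adjoint S ^ N) (blockPowCorner S H (adjoint S) (N + 1) (shiftPoly S ι p)) := by
      conv_lhs => rw [← Finsupp.sum_single p]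
      conv_rhs => rw [← Finsupp.sum_single p]
      simp only [Finsupp.sum, map_sum]
      refine Finset.sum_congr rfl fun n hn => ?_
      rw [hf, shiftPoly_single, h.adjoint_pow_corner hH,
        h.sum_pow_adjoint_pow_monomial (hN n hn), map_smul]
    rw [h1]
    exact (h.norm_adjoint_shift_pow_apply_le _ _).trans (hC _ _)
  refine ⟨f.extendOfNorm (shiftPoly S ι), fun n e => ?_⟩
  rw [← hf, ← shiftPoly_single, LinearMap.extendOfNorm_eq h.denseRange ⟨C, hbound⟩]

/-- On `zⁿ e` the left side has weight `n` in place of `n + 1`, as `S*` lowers the degree before `β`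
acts and the outer `S*` restores it through `H`. -/
theorem adjoint_mul_weighted_mul_adjoint {H β : K →L[ℂ] K} (hH : adjoint S * H = H * S)
    (hβ : ∀ (n : ℕ) e, β ((S ^ n) (ι e)) = ((n : ℂ) + 1) • H ((S ^ n) (ι e))) :
    adjoint S * β * adjoint S = β - H := by
  refine h.ext_on_monomials fun n e => ?_
  cases n with
  | zero =>
    have := hβ 0 e
    simp only [pow_zero, one_apply_eq_self, Nat.cast_zero, zero_add, one_smul] at this
    simp [h.adjoint_shift_iota, this]
  | succ n =>
    have h1 : adjoint S ((S ^ (n + 1)) (ι e)) = (S ^ n) (ι e) := by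
      rw [pow_succ']
      exact h.adjoint_apply_self _
    have h2 : adjoint S (H ((S ^ n) (ι e))) = H ((S ^ (n + 1)) (ι e)) := by
      rw [pow_succ']
      exact DFunLike.congr_fun hH ((S ^ n) (ι e))
    have h3 : (adjoint S * β * adjoint S) ((S ^ (n + 1)) (ι e)) =
        adjoint S (β (adjoint S ((S ^ (n + 1)) (ι e)))) := rfl
    rw [h3, h1, hβ, map_smul, h2, sub_apply, hβ]
    push_cast
    module

/-! #### Evaluation in the disc -/

omit h in
/-- The value at `w` of the analytic function `∑ wⁿ ι* S*ⁿ g`, in closed form. -/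
def _root_.FoguelHankel.discEval (S : K →L[ℂ] K) (ι : E →L[ℂ] K) (w : ℂ) : K →L[ℂ] E :=
  adjoint ι ∘L Ring.inverse (1 - w • adjoint S)

theorem norm_smul_adjoint_lt_one {w : ℂ} (hw : ‖w‖ < 1) : ‖w • adjoint S‖ < 1 := by
  rw [norm_smul]
  exact (mul_le_of_le_one_right (norm_nonneg _) h.norm_adjoint_shift_le_one).trans_lt hw

theorem isUnit_one_sub {w : ℂ} (hw : ‖w‖ < 1) : IsUnit (1 - w • adjoint S) :=
  isUnit_one_sub_of_norm_lt_one (h.norm_smul_adjoint_lt_one hw)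

theorem discEval_eq_tsum {w : ℂ} (hw : ‖w‖ < 1) (g : K) :
    discEval S ι w g = ∑' n : ℕ, w ^ n • adjoint ι ((adjoint S ^ n) g) := by
  have h1 := h.norm_smul_adjoint_lt_one hw
  have h2 := hasSum_geom_series_inverse _ h1
  have h3 := (h2.mapL (ContinuousLinearMap.apply ℂ K g)).mapL (adjoint ι)
  have h4 := h3.tsum_eq
  simp only [smul_pow] at h4
  simpa [discEval] using h4.symm

theorem differentiableOn_discEval :
    DifferentiableOn ℂ (discEval S ι) (Metric.ball 0 1) := by
  intro w hw
  have hu := h.isUnit_one_sub (mem_ball_zero_iff.1 hw)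
  have h1 : DifferentiableAt ℂ (fun w : ℂ => 1 - w • adjoint S) w := by fun_prop
  have h2 : DifferentiableAt ℂ (fun w : ℂ => Ring.inverse (1 - w • adjoint S)) w :=
    DifferentiableAt.comp w (g := Ring.inverse) (differentiableAt_inverse (𝕜 := ℂ) hu) h1
  exact ((differentiableAt_const (adjoint ι)).clm_comp h2).differentiableWithinAt

/-- The adjoint of evaluation at `w` produces the reproducing kernel `∑ w̄ⁿ Sⁿ ι e`; only this
fixed-point equation for it is needed. -/
theorem adjoint_discEval {w : ℂ} (hw : ‖w‖ < 1) (e : E) :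
    adjoint (discEval S ι w) e = ι e + (starRingEnd ℂ w) • S (adjoint (discEval S ι w) e) := by
  have h1 : discEval S ι w ∘L (1 - w • adjoint S) = adjoint ι := by
    have := Ring.inverse_mul_cancel _ (h.isUnit_one_sub hw)
    rw [discEval, ContinuousLinearMap.comp_assoc]
    have h2 : Ring.inverse (1 - w • adjoint S) ∘L (1 - w • adjoint S) = 1 := this
    rw [h2]
    rfl
  have h2 : ι e = (1 - (starRingEnd ℂ w) • S) (adjoint (discEval S ι w) e) := by
    refine ext_inner_right ℂ fun x => ?_
    rw [← adjoint_inner_right, ← h1, ContinuousLinearMap.comp_apply, ← adjoint_inner_left]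
    simp only [sub_apply, smul_apply,
      one_apply_eq_self, inner_sub_right, inner_sub_left, inner_smul_left,
      inner_smul_right, adjoint_inner_right, starRingEnd_self_apply]
  rw [h2]
  simp

theorem discEval_iota {w : ℂ} (hw : ‖w‖ < 1) (e : E) : discEval S ι w (ι e) = e := by
  refine ext_inner_left ℂ fun e' => ?_
  rw [← adjoint_inner_left, h.adjoint_discEval hw, inner_add_left, inner_smul_left,
    ← adjoint_inner_right S, h.adjoint_shift_iota, inner_zero_right, mul_zero, add_zero,
    ← adjoint_inner_right, h.adjoint_iota]

/-- The norm estimate for the symbol: if `k = ι e + w S k`, and `u = H k + w S* u`, the bound on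
the corners of the powers of `[[S, H], [0, S*]]` bounds the constant term of `u`. -/
theorem norm_adjoint_iota_le {H : K →L[ℂ] K} {C : ℝ} (hC0 : 0 ≤ C)
    (hC : ∀ n x, ‖blockPowCorner S H (adjoint S) n x‖ ≤ C * ‖x‖) {w : ℂ} (hw : ‖w‖ < 1)
    {e : E} {k u : K} (hk : k = ι e + w • S k) (hu : u = H k + w • adjoint S u) :
    ‖adjoint ι u‖ ≤ C * ‖e‖ := by
  have hk' : adjoint S k = w • k := by
    conv_lhs => rw [hk]
    rw [map_add, map_smul, h.adjoint_shift_iota, h.adjoint_apply_self, zero_add]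
  have hkn : ∀ n : ℕ, (adjoint S ^ n) k = w ^ n • k := by
    intro n
    induction n with
    | zero => simp
    | succ n ih =>
      rw [pow_succ, mul_apply_eq_comp, hk', map_smul, ih, smul_smul, pow_succ']
  have hPu : u - S (adjoint S u) = ι (adjoint ι u) := (h.iota_adjoint u).symm
  -- The added term `wⁿ S* u` makes the recursion orthogonal: since `H k = u - w S* u`, each step
  -- applies `S` and adds a vector `wⁿ (1 - S S*) u` orthogonal to its range.
  let G : ℕ → K := fun n => blockPowCorner S H (adjoint S) n k + w ^ n • adjoint S u
  have hG : ∀ n, G (n + 1) = S (G n) + (w ^ n • u - S (adjoint S (w ^ n • u))) := by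
    intro n
    have h1 : blockPowCorner S H (adjoint S) (n + 1) k =
        S (blockPowCorner S H (adjoint S) n k) + H ((adjoint S ^ n) k) := rfl
    have h2 : H k = u - w • adjoint S u := eq_sub_of_add_eq hu.symm
    simp only [G, h1, hkn, map_add, map_smul, h2, smul_sub, smul_smul, pow_succ]
    abel
  have hsum : ∀ n, (∑ i ∈ Finset.range n, (‖w‖ ^ 2) ^ i) * ‖adjoint ι u‖ ^ 2 ≤ ‖G n‖ ^ 2 := by
    intro n
    induction n with
    | zero => simp
    | succ n ih =>
      rw [hG, norm_sq_of_isometry h.adjoint_mul_self, Finset.sum_range_succ, add_mul]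
      refine add_le_add ih (le_of_eq ?_)
      rw [map_smul, map_smul, ← smul_sub, hPu, norm_smul, h.norm_iota, norm_pow]
      ring
  have hGn : ∀ n, ‖G n‖ ≤ C * ‖k‖ + ‖w‖ ^ n * ‖adjoint S u‖ := by
    intro n
    refine (norm_add_le _ _).trans (add_le_add (hC n k) ?_)
    rw [norm_smul, norm_pow]
  have hw2 : ‖w‖ ^ 2 < 1 := by nlinarith [norm_nonneg w]
  have hlim1 : Tendsto (fun n => (∑ i ∈ Finset.range n, (‖w‖ ^ 2) ^ i) * ‖adjoint ι u‖ ^ 2) atTop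
      (𝓝 ((1 - ‖w‖ ^ 2)⁻¹ * ‖adjoint ι u‖ ^ 2)) :=
    (hasSum_geometric_of_lt_one (sq_nonneg _) hw2).tendsto_sum_nat.mul_const _
  have hlim2 : Tendsto (fun n : ℕ => (C * ‖k‖ + ‖w‖ ^ n * ‖adjoint S u‖) ^ 2) atTop
      (𝓝 ((C * ‖k‖ + 0 * ‖adjoint S u‖) ^ 2)) :=
    ((tendsto_const_nhds.add
      ((tendsto_pow_atTop_nhds_zero_of_lt_one (norm_nonneg w) hw).mul_const _)).pow 2)
  have hle := le_of_tendsto_of_tendsto' hlim1 hlim2 fun n =>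
    (hsum n).trans (pow_le_pow_left₀ (norm_nonneg _) (hGn n) 2)
  -- The kernel satisfies `‖e‖² = (1 - |w|²) ‖k‖²`. This factor cancels the geometric sum `1 / (1 -
  -- |w|²)`, so the final bound does not depend on `w`.
  have hknorm : ‖k‖ ^ 2 = ‖w‖ ^ 2 * ‖k‖ ^ 2 + ‖e‖ ^ 2 := by
    have h1 := norm_sq_eq_of_isometry h.adjoint_mul_self k
    have h2 : k - S (adjoint S k) = ι e := by
      rw [hk', map_smul]
      exact sub_eq_of_eq_add hk
    rw [h2, h.norm_iota, hk', norm_smul, mul_pow] at h1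
    exact h1
  refine le_of_sq_le_sq ?_ (by positivity)
  have hpos : 0 < 1 - ‖w‖ ^ 2 := by linarith
  rw [inv_mul_le_iff₀ hpos] at hle
  have hke : ‖e‖ ^ 2 = (1 - ‖w‖ ^ 2) * ‖k‖ ^ 2 := by linarith
  rw [mul_pow, hke]
  linarith

/-- The adjoint of the symbol sends `e` to `ι* β k`, with `k` the kernel. As `S* k = w̄ k`, the
relation for `β` becomes the equation for `u = β k` in `norm_adjoint_iota_le`. -/
theorem norm_symbol_le {H β : K →L[ℂ] K} {C : ℝ} (hC0 : 0 ≤ C)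
    (hC : ∀ n x, ‖blockPowCorner S H (adjoint S) n x‖ ≤ C * ‖x‖)
    (hβ : adjoint S * β * adjoint S = β - H) {w : ℂ} (hw : ‖w‖ < 1) :
    ‖discEval S ι w ∘L adjoint β ∘L ι‖ ≤ C := by
  rw [← LinearIsometryEquiv.norm_map adjoint]
  refine ContinuousLinearMap.opNorm_le_bound _ hC0 fun e => ?_
  set k := adjoint (discEval S ι w) e with hkdef
  have hk := h.adjoint_discEval hw e
  rw [← hkdef] at hk
  have hk' : adjoint S k = (starRingEnd ℂ w) • k := by
    conv_lhs => rw [hk]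
    rw [map_add, map_smul, h.adjoint_shift_iota, h.adjoint_apply_self, zero_add]
  have hu : β k = H k + (starRingEnd ℂ w) • adjoint S (β k) := by
    have h1 : adjoint S (β (adjoint S k)) = β k - H k := DFunLike.congr_fun hβ k
    rw [hk', map_smul, map_smul] at h1
    rw [h1]
    abel
  have := h.norm_adjoint_iota_le hC0 hC (by simpa using hw) hk hu
  simpa [ContinuousLinearMap.adjoint_comp] using this

/-! #### Analytic multipliers and the sufficiency of the conditions -/

/-- The bound is assumed only for inner products with polynomials, the form in which a limit of
dilations supplies it. By density it is a norm bound, and `Sⁿ ι e ↦ Sⁿ A e` extends continuously. -/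
theorem exists_multiplier {A : E →L[ℂ] K} {C : ℝ} (hC0 : 0 ≤ C)
    (hA : ∀ p q : ℕ →₀ E, ‖inner ℂ (shiftPoly S ι q) (shiftPoly S A p)‖ ≤
      C * ‖shiftPoly S ι q‖ * ‖shiftPoly S ι p‖) :
    ∃ M : K →L[ℂ] K, M * S = S * M ∧ M ∘L ι = A := by
  have hbound : ∀ p, ‖shiftPoly S A p‖ ≤ C * ‖shiftPoly S ι p‖ := by
    intro p
    have h1 : ∀ x : K, ‖inner ℂ x (shiftPoly S A p)‖ ≤ C * ‖x‖ * ‖shiftPoly S ι p‖ := by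
      intro x
      refine h.denseRange.induction_on (p := fun x =>
        ‖inner ℂ x (shiftPoly S A p)‖ ≤ C * ‖x‖ * ‖shiftPoly S ι p‖) x ?_ (hA p)
      exact isClosed_le (by fun_prop) (by fun_prop)
    have h2 := h1 (shiftPoly S A p)
    rw [inner_self_eq_norm_sq_to_K] at h2
    have h3 : ‖shiftPoly S A p‖ ^ 2 ≤ C * ‖shiftPoly S A p‖ * ‖shiftPoly S ι p‖ := by
      simpa using h2
    rcases (norm_nonneg (shiftPoly S A p)).eq_or_lt with h0 | h0
    · rw [← h0]
      positivity
    · nlinarith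
  let M := (shiftPoly S A).extendOfNorm (shiftPoly S ι)
  have hM : ∀ (n : ℕ) e, M ((S ^ n) (ι e)) = (S ^ n) (A e) := by
    intro n e
    rw [← shiftPoly_single, ← shiftPoly_single,
      LinearMap.extendOfNorm_eq h.denseRange ⟨C, hbound⟩]
  refine ⟨M, h.ext_on_monomials fun n e => ?_, ContinuousLinearMap.ext fun e => hM 0 e⟩
  have h1 := hM (n + 1) e
  have h2 := congrArg S (hM n e)
  rw [pow_succ'] at h1
  exact h1.trans h2.symm

/-- With `Y = S* β`, one has `S Y - Y S* = S S* β - (β - H)`, and the missing `(1 - S S*) β` equals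
`(1 - S S*) M*` because `M` and `β*` agree on the constants. -/
theorem isSimilarToContraction_of_multiplier {H β M : K →L[ℂ] K}
    (hβ : adjoint S * β * adjoint S = β - H) (hMS : M * S = S * M)
    (hM : M ∘L ι = adjoint β ∘L ι) :
    IsSimilarToContraction (blockUpper S H (adjoint S)) := by
  have hM' : adjoint ι ∘L adjoint M = adjoint ι ∘L β := by
    rw [← ContinuousLinearMap.adjoint_comp, hM, ContinuousLinearMap.adjoint_comp, adjoint_adjoint]
  refine isSimilarToContraction_blockUpper (Y := adjoint S * β) (M := adjoint M)
    h.adjoint_mul_self ?_ ?_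
  · have := congrArg adjoint hMS
    rw [ContinuousLinearMap.mul_def, ContinuousLinearMap.mul_def, ContinuousLinearMap.adjoint_comp,
      ContinuousLinearMap.adjoint_comp] at this
    exact this.symm
  · have h1 : (1 - S * adjoint S) * adjoint M = (1 - S * adjoint S) * β := by
      rw [← h.comp_adjoint]
      exact congrArg (ι ∘L ·) hM'
    rw [h1, hβ]
    rw [sub_mul, one_mul, mul_assoc]
    abel

end IsUnilateralShift
end Shift

/-! ### The shift on the Hardy space -/

section Hardy

variable {E : Type*} [NormedAddCommGroup E] [InnerProductSpace ℂ E] [CompleteSpace E]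

omit [CompleteSpace E] in
theorem coeFn_shift (f : hardy E) :
    ((shift E f : hardy E) : L2 E) =ᵐ[haarAddCircle]
      fun t : UnitAddCircle => fourier 1 t • ((f : L2 E) : UnitAddCircle → E) t := by
  filter_upwards [(coordZ E).coeFn_mulOp (f : L2 E)] with t ht
  exact ht

omit [CompleteSpace E] in
theorem norm_shift_apply (f : hardy E) : ‖shift E f‖ = ‖f‖ := by
  rw [Submodule.coe_norm, Submodule.coe_norm, Lp.norm_def, Lp.norm_def]
  congr 1
  refine eLpNorm_congr_norm_ae ?_
  filter_upwards [coeFn_shift f] with t ht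
  rw [ht]
  simp [norm_smul, Circle.norm_coe]

theorem shift_monomial (n : ℕ) (e : E) : shift E (monomial E n e) = monomial E (n + 1) e := by
  refine Subtype.ext (Lp.ext ?_)
  filter_upwards [coeFn_shift (monomial E n e), coeFn_monomial n e, coeFn_monomial (n + 1) e]
    with t h1 h2 h3
  rw [h1, h2, h3, smul_smul, ← fourier_add, add_comm (1 : ℤ), Nat.cast_succ]

/-- The inclusion of the constants, as a bounded operator. -/
def constL (E : Type*) [NormedAddCommGroup E] [InnerProductSpace ℂ E] [CompleteSpace E] :
    E →L[ℂ] hardy E :=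
  (monomial E 0).mkContinuous 1 fun e => by rw [norm_monomial, one_mul]

theorem constL_apply (e : E) : constL E e = monomial E 0 e := rfl

theorem shift_pow_constL (n : ℕ) (e : E) : (shift E ^ n) (constL E e) = monomial E n e := by
  induction n with
  | zero => rfl
  | succ n ih => rw [pow_succ', mul_apply_eq_comp, ih, shift_monomial]

omit [CompleteSpace E] in
theorem integrable_fourier_smul (n : ℤ) (f : L2 E) :
    Integrable (fun t : UnitAddCircle => fourier (-n) t • f t) haarAddCircle := by
  have hf : Integrable (f : UnitAddCircle → E) haarAddCircle :=
    (Lp.memLp f).integrable one_le_two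
  refine hf.bdd_smul (C := 1) (ContinuousMap.continuous _).aestronglyMeasurable ?_
  exact Eventually.of_forall fun t => by simp [Circle.norm_coe]

theorem inner_monomial_L2 (n : ℕ) (e : E) (f : L2 E) :
    inner ℂ ((monomial E n e : hardy E) : L2 E) f =
      inner ℂ e (fourierCoeff (f : UnitAddCircle → E) n) := by
  have hint := integrable_fourier_smul n f
  rw [L2.inner_def, fourierCoeff, ← integral_inner hint]
  refine integral_congr_ae ?_
  filter_upwards [coeFn_monomial n e] with t ht
  rw [ht, inner_smul_left, inner_smul_right, fourier_neg]

theorem inner_monomial (n : ℕ) (e : E) (f : hardy E) :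
    inner ℂ (monomial E n e) f = inner ℂ e (fourierCoeff ((f : L2 E) : UnitAddCircle → E) n) :=
  inner_monomial_L2 n e f

theorem adjoint_constL_pow (n : ℕ) (f : hardy E) :
    adjoint (constL E) ((adjoint (shift E) ^ n) f) =
      fourierCoeff ((f : L2 E) : UnitAddCircle → E) n := by
  refine ext_inner_left ℂ fun e => ?_
  rw [← inner_monomial, ← shift_pow_constL, adjoint_inner_right]
  have : adjoint (shift E) ^ n = adjoint (shift E ^ n) := (star_pow (shift E) n).symm
  rw [this, adjoint_inner_right]

theorem adjoint_constL_constL (e : E) : adjoint (constL E) (constL E e) = e := by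
  have h1 : ∀ x, ‖constL E x‖ = ‖x‖ := fun x => norm_monomial 0 x
  exact DFunLike.congr_fun ((ContinuousLinearMap.norm_map_iff_adjoint_comp_self _).1 h1) e

theorem adjoint_shift_mul_shift : adjoint (shift E) * shift E = 1 :=
  (ContinuousLinearMap.norm_map_iff_adjoint_comp_self _).1 norm_shift_apply

theorem adjoint_constL_shift (f : hardy E) : adjoint (constL E) (shift E f) = 0 := by
  have h1 := adjoint_constL_pow 0 (shift E f)
  rw [pow_zero, one_apply_eq_self] at h1
  rw [h1, fourierCoeff_congr_ae (coeFn_shift f), fourierCoeff_fourier_smul]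
  exact mem_hardy.1 f.2 _ (by norm_num)

theorem adjoint_shift_constL (e : E) : adjoint (shift E) (constL E e) = 0 := by
  refine ext_inner_left ℂ fun f => ?_
  rw [adjoint_inner_right, ← adjoint_inner_left, adjoint_constL_shift, inner_zero_left,
    inner_zero_right]

variable [TopologicalSpace.SeparableSpace E]

omit [TopologicalSpace.SeparableSpace E] in
theorem fourierCoeff_inner (f : L2 E) (e : E) (n : ℤ) :
    fourierCoeff ((ContinuousLinearMap.compLp (innerSL ℂ e) f : Lp ℂ 2 haarAddCircle) :
      UnitAddCircle → ℂ) n = innerSL ℂ e (fourierCoeff (f : UnitAddCircle → E) n) := by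
  rw [fourierCoeff_congr_ae (ContinuousLinearMap.coeFn_compLp (innerSL ℂ e) f), fourierCoeff,
    fourierCoeff, ← ContinuousLinearMap.integral_comp_comm _ (integrable_fourier_smul n f)]
  simp only [map_smul]

/-- Pairing with each `e` reduces to the scalar Fourier basis. The exceptional null set depends on
`e`, and separability makes countably many `e` enough. -/
theorem L2_eq_zero_of_fourierCoeff {f : L2 E}
    (hf : ∀ n : ℤ, fourierCoeff (f : UnitAddCircle → E) n = 0) : f = 0 := by
  have : SecondCountableTopology E := UniformSpace.secondCountable_of_separable E
  rw [Lp.eq_zero_iff_ae_eq_zero]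
  refine ae_eq_zero_of_forall_inner (𝕜 := ℂ) fun e => ?_
  have h1 : (ContinuousLinearMap.compLp (innerSL ℂ e) f : Lp ℂ 2 haarAddCircle) = 0 := by
    refine fourierBasis.repr.injective (lp.ext (funext fun n => ?_))
    rw [fourierBasis_repr, fourierCoeff_inner, hf, map_zero, map_zero]
    rfl
  have h2 := ContinuousLinearMap.coeFn_compLp (innerSL ℂ e) f
  rw [h1] at h2
  filter_upwards [h2, Lp.coeFn_zero ℂ 2 (haarAddCircle : Measure UnitAddCircle)] with t h3 h4
  rw [h4] at h3
  exact h3.symm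

theorem hardy_ext {f g : hardy E}
    (hfg : ∀ n : ℕ, adjoint (constL E) ((adjoint (shift E) ^ n) f) =
      adjoint (constL E) ((adjoint (shift E) ^ n) g)) : f = g := by
  rw [← sub_eq_zero]
  refine Subtype.ext (L2_eq_zero_of_fourierCoeff fun n => ?_)
  rcases lt_or_ge n 0 with hn | hn
  · exact mem_hardy.1 (f - g).2 n hn
  · obtain ⟨m, rfl⟩ := Int.eq_ofNat_of_zero_le hn
    rw [← adjoint_constL_pow m (f - g), map_sub, map_sub, hfg, sub_self]

variable (E) in
theorem isUnilateralShift_shift : IsUnilateralShift (shift E) (constL E) where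
  adjoint_mul_self := adjoint_shift_mul_shift
  adjoint_comp_self := ContinuousLinearMap.ext adjoint_constL_constL
  comp_adjoint := by
    refine ContinuousLinearMap.ext fun f => hardy_ext fun n => ?_
    have hS : ∀ x, adjoint (shift E) (shift E x) = x :=
      DFunLike.congr_fun adjoint_shift_mul_shift
    have h1 : (1 - shift E * adjoint (shift E)) f = f - shift E (adjoint (shift E) f) := rfl
    rw [h1, ContinuousLinearMap.comp_apply]
    cases n with
    | zero => simp [adjoint_constL_constL, adjoint_constL_shift]
    | succ n =>
      rw [pow_succ, mul_apply_eq_comp, mul_apply_eq_comp, adjoint_shift_constL, map_sub, hS,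
        sub_self]
  denseRange := by
    have h1 : (LinearMap.range (shiftPoly (shift E) (constL E))).topologicalClosure = ⊤ := by
      rw [Submodule.topologicalClosure_eq_top_iff, Submodule.eq_bot_iff]
      intro f hf
      refine hardy_ext fun n => ext_inner_left ℂ fun e => ?_
      rw [map_zero, map_zero, inner_zero_right, adjoint_constL_pow, ← inner_monomial,
        ← shift_pow_constL, ← shiftPoly_single]
      exact Submodule.inner_right_of_mem_orthogonal (LinearMap.mem_range_self _ _) hf
    exact Submodule.dense_iff_topologicalClosure_eq_top.2 h1

theorem hardyEval_eq_discEval (f : hardy E) {w : ℂ} (hw : ‖w‖ < 1) :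
    hardyEval f w = discEval (shift E) (constL E) w f := by
  rw [(isUnilateralShift_shift E).discEval_eq_tsum hw]
  simp only [adjoint_constL_pow]
  rfl

omit [TopologicalSpace.SeparableSpace E] in
theorem polyToHardy_eq : polyToHardy E = shiftPoly (shift E) (constL E) := by
  ext n e : 2
  refine Eq.trans ?_ ((shiftPoly_single _ _ n e).trans (shift_pow_constL n e)).symm
  simp [polyToHardy]

omit [TopologicalSpace.SeparableSpace E] in
theorem projE_apply (f : hardy E) : projE E f = constL E (adjoint (constL E) f) := by
  refine Submodule.eq_starProjection_of_mem_of_inner_eq_zero ⟨_, rfl⟩ ?_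
  rintro _ ⟨e, rfl⟩
  rw [← constL_apply, ← adjoint_inner_left, map_sub, adjoint_constL_constL, sub_self,
    inner_zero_left]

omit [TopologicalSpace.SeparableSpace E] in
-- The flip turns multiplication by `z` into multiplication by `z̄`, which commutes with `Φ`; the
-- two integrands agree almost everywhere.
theorem adjoint_shift_mul_hankel (Φ : LInfty E) :
    adjoint (shift E) * hankel Φ = hankel Φ * shift E := by
  refine ContinuousLinearMap.ext fun y => ext_inner_left ℂ fun x => ?_
  have h1 : ∀ u v : hardy E, inner ℂ u (hankel Φ v) =
      inner ℂ (u : L2 E) (Φ.mulOp (flip E (v : L2 E))) := by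
    intro u v
    exact Submodule.inner_orthogonalProjectionOnto_eq_of_mem_left u _
  have hflip : ∀ v : L2 E, flip E v =ᵐ[haarAddCircle] fun t : UnitAddCircle => v (-t) := fun v =>
    Lp.coeFn_compMeasurePreserving v
      (Measure.measurePreserving_neg (haarAddCircle : Measure UnitAddCircle))
  rw [mul_apply_eq_comp, mul_apply_eq_comp, adjoint_inner_right, h1, h1, L2.inner_def, L2.inner_def]
  have hneg := (Measure.measurePreserving_neg
    (haarAddCircle : Measure UnitAddCircle)).quasiMeasurePreserving.ae_eq_comp (coeFn_shift y)
  refine integral_congr_ae ?_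
  filter_upwards [coeFn_shift x, Φ.coeFn_mulOp (flip E (y : L2 E)),
    Φ.coeFn_mulOp (flip E ((shift E y : hardy E) : L2 E)), hflip y, hflip (shift E y : hardy E),
    hneg] with t h1 h2 h3 h4 h5 h6
  simp only [Function.comp_apply] at h6
  rw [h1, h2, h3, h4, h5, h6, map_smul, inner_smul_left, inner_smul_right, ← fourier_neg]
  simp [fourier_apply]

end Hardy

/-! ### Multiplication by bounded analytic functions -/

section Dilation

variable {E : Type*} [NormedAddCommGroup E] [InnerProductSpace ℂ E]

theorem norm_mul_fourier_lt_one {r : ℝ} (hr : |r| < 1) (t : UnitAddCircle) :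
    ‖(r : ℂ) * fourier 1 t‖ < 1 := by
  rw [norm_mul, Complex.norm_real, Real.norm_eq_abs, fourier_apply, Circle.norm_coe, mul_one]
  exact hr

/-- The dilation `z ↦ Ψ (r z)` as a function on the circle. -/
def HInfty.dilate (Ψ : HInfty E) (r : ℝ) (hr : |r| < 1) : LInfty E where
  toFun t := Ψ.toFun (r * fourier 1 t)
  measurable e := by
    have h1 : Continuous fun t : UnitAddCircle => Ψ.toFun (r * fourier 1 t) :=
      Ψ.analytic.continuousOn.comp_continuous (by fun_prop)
        fun t => mem_ball_zero_iff.2 (norm_mul_fourier_lt_one hr t)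
    exact (h1.clm_apply continuous_const).aestronglyMeasurable
  bounded := by
    obtain ⟨C, hC⟩ := Ψ.bounded
    exact ⟨C, Eventually.of_forall fun t =>
      hC _ (mem_ball_zero_iff.2 (norm_mul_fourier_lt_one hr t))⟩

theorem HInfty.norm_dilate_mulOp_le (Ψ : HInfty E) {C : ℝ}
    (hC : ∀ w ∈ Metric.ball (0 : ℂ) 1, ‖Ψ.toFun w‖ ≤ C) (r : ℝ) (hr : |r| < 1) (f : L2 E) :
    ‖(Ψ.dilate r hr).mulOp f‖ ≤ C * ‖f‖ := by
  refine Lp.norm_le_mul_norm_of_ae_le_mul ?_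
  filter_upwards [(Ψ.dilate r hr).coeFn_mulOp f] with t ht
  rw [ht]
  exact ContinuousLinearMap.le_of_opNorm_le _
    (hC _ (mem_ball_zero_iff.2 (norm_mul_fourier_lt_one hr t))) _

theorem integral_fourier (k : ℤ) :
    ∫ t : UnitAddCircle, fourier k t ∂haarAddCircle = if k = 0 then 1 else 0 := by
  have h0 := congrFun (fourierCoeff_fourier (T := (1 : ℝ)) k) 0
  simp only [fourierCoeff, neg_zero, fourier_zero, one_smul] at h0
  rw [h0, Pi.single_apply]
  simp [eq_comm]

variable [CompleteSpace E]

theorem fourierCoeff_powerSeries {a : ℕ → E} {A : ℝ} (ha : ∀ m, ‖a m‖ ≤ A) {r : ℝ} (hr : |r| < 1)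
    (k : ℤ) :
    fourierCoeff (fun t : UnitAddCircle => ∑' m : ℕ, ((r : ℂ) * fourier 1 t) ^ m • a m) k =
      if 0 ≤ k then (r : ℂ) ^ k.toNat • a k.toNat else 0 := by
  let F : ℕ → UnitAddCircle → E := fun m t => fourier (m - k) t • ((r : ℂ) ^ m • a m)
  have hF : ∀ t : UnitAddCircle, (fourier (-k) t : ℂ) •
      ∑' m : ℕ, ((r : ℂ) * fourier 1 t) ^ m • a m = ∑' m, F m t := by
    intro t
    rw [← tsum_const_smul'']
    refine tsum_congr fun m => ?_
    have h1 : (fourier 1 t : ℂ) ^ m = fourier (m : ℤ) t := by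
      simp [fourier_apply, AddCircle.toCircle_nsmul]
    simp only [F]
    rw [mul_pow, h1, smul_smul, smul_smul, sub_eq_add_neg, fourier_add]
    congr 1
    ring
  have hFn : ∀ m t, ‖F m t‖ = |r| ^ m * ‖a m‖ := by
    intro m t
    simp [F, norm_smul, Circle.norm_coe]
  have hFc : ∀ m, Continuous (F m) := fun m => by fun_prop
  have hFi : ∀ m, Integrable (F m) haarAddCircle := fun m =>
    (hFc m).integrable_of_hasCompactSupport (HasCompactSupport.of_compactSpace _)
  have hsum : Summable fun m => ∫ t : UnitAddCircle, ‖F m t‖ ∂haarAddCircle := by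
    simp only [hFn, integral_const, probReal_univ, one_smul]
    refine Summable.of_nonneg_of_le (fun m => by positivity)
      (fun m => mul_le_mul_of_nonneg_left (ha m) (by positivity)) ?_
    exact (summable_geometric_of_lt_one (abs_nonneg r) hr).mul_right A
  have hint : ∀ m : ℕ, ∫ t : UnitAddCircle, F m t ∂haarAddCircle =
      if (m : ℤ) = k then (r : ℂ) ^ m • a m else 0 := by
    intro m
    simp only [F]
    rw [integral_smul_const, integral_fourier]
    simp [sub_eq_zero]
  rw [fourierCoeff]
  simp only [hF]
  rw [← integral_tsum_of_summable_integral_norm hFi hsum]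
  simp only [hint]
  split_ifs with hk
  · obtain ⟨n, rfl⟩ := Int.eq_ofNat_of_zero_le hk
    rw [tsum_eq_single n fun m hm => if_neg (by simpa using hm)]
    simp
  · refine (tsum_congr fun m => if_neg (by omega)).trans tsum_zero

variable [TopologicalSpace.SeparableSpace E]

/-- For `j < n` the truncated exponent `j - n` is harmless: both inner products vanish. -/
theorem inner_dilate_monomial (Ψ : HInfty E) {A : E →L[ℂ] hardy E}
    (hA : ∀ w ∈ Metric.ball (0 : ℂ) 1, ∀ e, Ψ.toFun w e = hardyEval (A e) w)
    (r : ℝ) (hr : |r| < 1) (j n : ℕ) (e' e : E) :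
    inner ℂ ((monomial E j e' : hardy E) : L2 E)
        ((Ψ.dilate r hr).mulOp ((monomial E n e : hardy E) : L2 E)) =
      (r : ℂ) ^ (j - n) * inner ℂ (monomial E j e') ((shift E ^ n) (A e)) := by
  let a : ℕ → E := fun m => adjoint (constL E) ((adjoint (shift E) ^ m) (A e))
  have h := isUnilateralShift_shift E
  have ha : ∀ m, ‖a m‖ ≤ ‖adjoint (constL E)‖ * ‖A e‖ := fun m =>
    (adjoint (constL E)).le_opNorm_of_le (h.norm_adjoint_shift_pow_apply_le m _)
  have h1 : fourierCoeff ((Ψ.dilate r hr).mulOp ((monomial E n e : hardy E) : L2 E) :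
      UnitAddCircle → E) j = if (n : ℤ) ≤ j then (r : ℂ) ^ (j - n) • a (j - n) else 0 := by
    have h2 : ((Ψ.dilate r hr).mulOp ((monomial E n e : hardy E) : L2 E) :
        UnitAddCircle → E) =ᵐ[haarAddCircle] fun t : UnitAddCircle => fourier (n : ℤ) t •
          ∑' m : ℕ, ((r : ℂ) * fourier 1 t) ^ m • a m := by
      filter_upwards [(Ψ.dilate r hr).coeFn_mulOp ((monomial E n e : hardy E) : L2 E),
        coeFn_monomial n e] with t h3 h4
      have h5 := norm_mul_fourier_lt_one hr t
      rw [h3, h4, map_smul]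
      congr 1
      have h6 : (Ψ.dilate r hr).toFun t e = hardyEval (A e) (r * fourier 1 t) :=
        hA _ (mem_ball_zero_iff.2 h5) e
      rw [h6, hardyEval_eq_discEval _ h5, h.discEval_eq_tsum h5]
    rw [fourierCoeff_congr_ae h2, fourierCoeff_fourier_smul, fourierCoeff_powerSeries ha hr]
    have h3 : ((j : ℤ) - n).toNat = j - n := by omega
    simp only [h3, sub_nonneg]
  rw [inner_monomial_L2, h1, inner_monomial, ← adjoint_constL_pow]
  split_ifs with hjn
  · obtain ⟨l, rfl⟩ := Nat.exists_eq_add_of_le (Int.ofNat_le.1 hjn)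
    have h2 : (adjoint (shift E) ^ (n + l)) ((shift E ^ n) (A e)) =
        (adjoint (shift E) ^ l) (A e) := by
      rw [add_comm, pow_add, mul_apply_eq_comp, h.adjoint_pow_apply_pow]
    rw [h2, inner_smul_right, Nat.add_sub_cancel_left]
  · obtain ⟨l, rfl⟩ := Nat.exists_eq_add_of_lt (by omega : j < n)
    have h2 : (adjoint (shift E) ^ j) ((shift E ^ (j + l + 1)) (A e)) =
        shift E ((shift E ^ l) (A e)) := by
      rw [add_assoc, pow_add, mul_apply_eq_comp, h.adjoint_pow_apply_pow, pow_succ']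
      rfl
    rw [h2, adjoint_constL_shift, inner_zero_right, mul_zero]

/-- Dilations `Ψ(r z)` are continuous on the circle and act with norm at most `C`. Letting `r → 1`
in inner products of polynomials avoids any boundary values of `Ψ`. -/
theorem norm_inner_shiftPoly_le (Ψ : HInfty E) {A : E →L[ℂ] hardy E}
    (hA : ∀ w ∈ Metric.ball (0 : ℂ) 1, ∀ e, Ψ.toFun w e = hardyEval (A e) w) {C : ℝ}
    (hC : ∀ w ∈ Metric.ball (0 : ℂ) 1, ‖Ψ.toFun w‖ ≤ C) (p q : ℕ →₀ E) :
    ‖inner ℂ (shiftPoly (shift E) (constL E) q) (shiftPoly (shift E) A p)‖ ≤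
      C * ‖shiftPoly (shift E) (constL E) q‖ * ‖shiftPoly (shift E) (constL E) p‖ := by
  let ρ : ℕ → ℝ := fun n => 1 - 1 / ((n : ℝ) + 1)
  have hρ : ∀ n, |ρ n| < 1 := by
    intro n
    have h1 : 0 < 1 / ((n : ℝ) + 1) := by positivity
    have h2 : 1 / ((n : ℝ) + 1) ≤ 1 := by
      rw [div_le_one (by positivity)]
      linarith [(Nat.cast_nonneg n : (0 : ℝ) ≤ n)]
    rw [abs_lt]
    constructor <;> simp only [ρ] <;> linarith
  have hlim : Tendsto (fun n => (ρ n : ℂ)) atTop (𝓝 1) := by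
    have h1 : Tendsto ρ atTop (𝓝 (1 - 0)) :=
      tendsto_const_nhds.sub tendsto_one_div_add_atTop_nhds_zero_nat
    rw [sub_zero] at h1
    exact_mod_cast (Complex.continuous_ofReal.tendsto 1).comp h1
  let P := shiftPoly (shift E) (constL E)
  have key : Tendsto (fun n => inner ℂ ((P q : hardy E) : L2 E)
      ((Ψ.dilate (ρ n) (hρ n)).mulOp ((P p : hardy E) : L2 E))) atTop
      (𝓝 (inner ℂ (P q) (shiftPoly (shift E) A p))) := by
    induction q using Finsupp.induction_linear with
    | zero => simp
    | add q₁ q₂ h₁ h₂ =>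
      simp only [map_add, Submodule.coe_add, inner_add_left]
      exact h₁.add h₂
    | single j e' =>
      induction p using Finsupp.induction_linear with
      | zero => simp
      | add p₁ p₂ h₁ h₂ =>
        simp only [map_add, Submodule.coe_add, inner_add_right]
        exact h₁.add h₂
      | single n e =>
        simp only [P, shiftPoly_single, shift_pow_constL]
        simp only [inner_dilate_monomial Ψ hA]
        have h1 := (hlim.pow (j - n)).mul_const
          (inner ℂ (monomial E j e') ((shift E ^ n) (A e)))
        rwa [one_pow, one_mul] at h1
  refine le_of_tendsto' key.norm fun n => ?_
  refine (norm_inner_le_norm _ _).trans ?_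
  have h1 := Ψ.norm_dilate_mulOp_le hC (ρ n) (hρ n) ((P p : hardy E) : L2 E)
  calc _ ≤ ‖P q‖ * (C * ‖P p‖) := mul_le_mul_of_nonneg_left h1 (norm_nonneg _)
    _ = _ := by ring

/-! ### The two implications -/

theorem exists_extension_and_symbol {Φ : LInfty E}
    (hsim : IsSimilarToContraction (blockUpper (shift E) (hankel Φ) (adjoint (shift E)))) :
    ∃ B : hardy E →L[ℂ] hardy E, ExtendsHankelDiff Φ B ∧ ∃ Ψ : HInfty E, ∀ f : hardy E,
      Ψ.IsMul (projE E f) (adjoint (B ∘L shift E) (projE E f)) := by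
  have h := isUnilateralShift_shift E
  obtain ⟨C, hC⟩ := hsim.exists_pow_le
  have hC0 : 0 ≤ C :=
    (norm_nonneg (blockUpper (shift E) (hankel Φ) (adjoint (shift E)) ^ 0)).trans (hC 0)
  have hcorner : ∀ n x,
      ‖blockPowCorner (shift E) (hankel Φ) (adjoint (shift E)) n x‖ ≤ C * ‖x‖ := by
    intro n x
    refine (norm_corner_apply_le (shift E ^ n) _ (adjoint (shift E) ^ n) x).trans ?_
    rw [← blockUpper_pow]
    exact mul_le_mul_of_nonneg_right (hC n) (norm_nonneg x)
  have hH := adjoint_shift_mul_hankel Φ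
  obtain ⟨β, hβ⟩ := h.exists_weighted_hankel hH hcorner
  have hβ' := h.adjoint_mul_weighted_mul_adjoint hH hβ
  have hB : (β ∘L adjoint (shift E)) ∘L shift E = β := by
    ext1 x
    exact congrArg β (h.adjoint_apply_self x)
  -- `D` kills the constants, as `S*` does, and `D S S* = D` on polynomials; hence `H D = β S*`.
  refine ⟨β ∘L adjoint (shift E), ?_, ⟨fun w => discEval (shift E) (constL E) w ∘L
    adjoint β ∘L constL E, ?_, ⟨C, fun w hw => ?_⟩⟩, fun f w hw => ?_⟩
  · intro p
    induction p using Finsupp.induction_linear with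
    | zero => simp
    | add p₁ p₂ h₁ h₂ => simp only [map_add, h₁, h₂]
    | single n e =>
      have h1 : diffPoly E (Finsupp.single n e) = (n : ℂ) • Finsupp.single (n - 1) e := by
        simp [diffPoly]
      rw [h1, map_smul, map_smul, polyToHardy_eq, shiftPoly_single, shiftPoly_single,
        ContinuousLinearMap.comp_apply]
      cases n with
      | zero => simp [h.adjoint_shift_iota]
      | succ n =>
        rw [pow_succ', mul_apply_eq_comp, h.adjoint_apply_self, hβ, Nat.add_sub_cancel]
        push_cast
        rfl
  · exact h.differentiableOn_discEval.clm_comp (differentiableOn_const _)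
  · exact h.norm_symbol_le hC0 hcorner hβ' (mem_ball_zero_iff.1 hw)
  · have hw' := mem_ball_zero_iff.1 hw
    rw [hB, hardyEval_eq_discEval _ hw', hardyEval_eq_discEval _ hw', projE_apply,
      h.discEval_iota hw']
    rfl

theorem isSimilarToContraction_of_symbol {Φ : LInfty E} {B : hardy E →L[ℂ] hardy E}
    (hB : ExtendsHankelDiff Φ B) {Ψ : HInfty E}
    (hΨ : ∀ f : hardy E, Ψ.IsMul (projE E f) (adjoint (B ∘L shift E) (projE E f))) :
    IsSimilarToContraction (blockUpper (shift E) (hankel Φ) (adjoint (shift E))) := by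
  have h := isUnilateralShift_shift E
  have hβ : ∀ (n : ℕ) e, (B ∘L shift E) ((shift E ^ n) (constL E e)) =
      ((n : ℂ) + 1) • hankel Φ ((shift E ^ n) (constL E e)) := by
    intro n e
    have h1 := hB (Finsupp.single (n + 1) e)
    have h2 : diffPoly E (Finsupp.single (n + 1) e) =
        ((n : ℂ) + 1) • Finsupp.single n e := by
      simp [diffPoly]
    rw [h2, map_smul, map_smul, polyToHardy_eq, shiftPoly_single, shiftPoly_single, pow_succ'] at h1
    exact h1
  have hβ' := h.adjoint_mul_weighted_mul_adjoint (adjoint_shift_mul_hankel Φ) hβ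
  obtain ⟨C, hC⟩ := Ψ.bounded
  have hC0 : 0 ≤ C := (norm_nonneg _).trans (hC 0 (by simp))
  -- On a constant `e` the projection does nothing, so condition 2 identifies `Ψ(w) e` with the
  -- value at `w` of `(B S)* ι e`.
  have hA : ∀ w ∈ Metric.ball (0 : ℂ) 1, ∀ e,
      Ψ.toFun w e = hardyEval ((adjoint (B ∘L shift E) ∘L constL E) e) w := by
    intro w hw e
    have hw' := mem_ball_zero_iff.1 hw
    have h1 := hΨ (constL E e) w hw
    rw [projE_apply, h.adjoint_iota, hardyEval_eq_discEval (constL E e) hw',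
      h.discEval_iota hw'] at h1
    exact h1.symm
  obtain ⟨M, hMS, hM⟩ := h.exists_multiplier hC0 (norm_inner_shiftPoly_le Ψ hA hC)
  exact h.isSimilarToContraction_of_multiplier hβ' hMS hM

end Dilation

end FoguelHankel

end

theorem theorem4p1 {E : Type*} [NormedAddCommGroup E] [InnerProductSpace ℂ E] [CompleteSpace E]
    [TopologicalSpace.SeparableSpace E] (Φ : FoguelHankel.LInfty E) :
    FoguelHankel.IsSimilarToContraction
        (FoguelHankel.blockUpper (FoguelHankel.shift E) (FoguelHankel.hankel Φ)
          (ContinuousLinearMap.adjoint (FoguelHankel.shift E))) ↔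
      ∃ B : FoguelHankel.hardy E →L[ℂ] FoguelHankel.hardy E,
        FoguelHankel.ExtendsHankelDiff Φ B ∧
        ∃ Ψ : FoguelHankel.HInfty E, ∀ f : FoguelHankel.hardy E,
          Ψ.IsMul (FoguelHankel.projE E f)
            (ContinuousLinearMap.adjoint (B ∘L FoguelHankel.shift E)
              (FoguelHankel.projE E f)) :=
  ⟨FoguelHankel.exists_extension_and_symbol, fun ⟨_, hB, _, hΨ⟩ =>
    FoguelHankel.isSimilarToContraction_of_symbol hB hΨ⟩
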